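/- Let $\mathbf{Met}$ be the category of extended metric spaces (the distance $\infty$ is allowed) and nonexpanding maps. A metric-enriched category is a category $\mathcal{K}$ with an extended metric on every hom-set $\mathcal{K}(X,Y)$ such that $d(g f, g' f') \le d(f,f') + d(g,g')$ for all $f,f'\colon X\to Y$ and $g,g'\colon Y\to Z$. Weighted colimits are understood in the sense of enrichment over $\mathbf{Met}$; ordinary colimits, such as coequalizers, are conical, i.e. weighted by the constant weight with value the one-point space. An object $G$ of $\mathcal{K}$ has tensors if for every space $M$ there is an object $M\otimes G$ with isomorphisms of metric spaces $\mathcal{K}(M\otimes G,X)\cong\mathbf{Met}(M,\mathcal{K}(G,X))$, natural in $X$, where $\mathbf{Met}(M,N)$ carries the supremum metric. For a set $S$, considered as a discrete space (all distances $0$ or $\infty$), $S\otimes G$ is the copower $\coprod_S G$. A morphism $e\colon X\to Y$ is a subregular epimorphism if it is the colimit map of a basic diagram: $\mathcal{B}$ is the (discretely enriched) category obtained from the chain of all real numbers $\varepsilon\ge 0$ by adding an object $a$ and two cocones $l_\varepsilon, r_\varepsilon\colon\varepsilon\to a$; the basic weight $B\colon\mathcal{B}^{\mathrm{op}}\to\mathbf{Met}$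 has $Ba=\{*\}$, $B\varepsilon=\{0,1\}$ with $d(0,1)=\varepsilon$ (the two points being identified if $\varepsilon=0$), is carried by the identity of $\{0,1\}$ on $\varepsilon\to\varepsilon'$, and $Bl_\varepsilon$, $Br_\varepsilon$ pick out $0$ and $1$; the colimit map of a diagram $D\colon\mathcal{B}\to\mathcal{K}$ with $Da=X$ and colimit $Y$ weighted by $B$ is the morphism $Da\to Y$ which is the value at $*$ of the $a$-component of the unit $B\to\mathcal{K}(D-,Y)$. An object $G$ with tensors is a subvarietal generator if 1. for every object $X$ the evaluation morphism $\mathcal{K}(G,X)\otimes G\to X$ corresponding to $\mathrm{id}_{\mathcal{K}(G,X)}$ is a subregular epimorphism; 2. $G$ is abstractly finite: for every set $S$, every morphism $G\to\coprod_S G$ factorizes through $\coprod_{S'}G$ for some finite subset $S'\subseteq S$; 3. $G$ is a subregular projective: for every subregular epimorphism $e\colon X\to Y$ every morphism $G\to Y$ factorizes through $e$. Theorem. Let $\mathcal{K}$ be a metric-enriched category with coequalizers of reflexive pairs and with a subvarietal generator $G$. Let $\mathcal{A}$ be the full subcategory of $\mathcal{K}$ on all finite copowers $n\otimes G=\coprod_n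 G$ ($n\in\mathbb{N}$) of $G$. Then $\mathcal{A}$ is dense in $\mathcal{K}$. That is, let $[\mathcal{A}^{\mathrm{op}},\mathbf{Met}]$ be the category of locally nonexpanding functors and natural transformations, with $d(\sigma,\tau)=\sup_{A} d(\sigma_A,\tau_A)$. Then the functor $E\colon\mathcal{K}\to[\mathcal{A}^{\mathrm{op}},\mathbf{Met}]$ which assigns to $K$ the restriction of $\mathcal{K}(-,K)$ to $\mathcal{A}^{\mathrm{op}}$ is full and satisfies $d(f,f')=d(Ef,Ef')$ for all parallel pairs $f,f'$ in $\mathcal{K}$. -/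

import Mathlib

open CategoryTheory Opposite
open scoped NNReal ENNReal

universe v u v₁ u₁

namespace MetCat

/-! ### The category of extended metric spaces and nonexpanding maps -/

/-- Extended metric spaces: the distance `∞` is allowed, and points at distance `0` are equal.
(The topology and the uniformity carried by Mathlib's class are determined by the metric.) -/
structure Met : Type (v + 1) where
  carrier : Type v
  [str : EMetricSpace carrier]

namespace Met

instance : CoeSort Met.{v} (Type v) := ⟨Met.carrier⟩

instance (M : Met.{v}) : EMetricSpace M := M.str

/-- Nonexpanding maps. -/
@[ext]
structure Hom (M N : Met.{v}) : Type v where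
  toFun : M → N
  nonexpanding : ∀ x y : M, edist (toFun x) (toFun y) ≤ edist x y

instance : Category.{v} Met.{v} where
  Hom := Hom
  id M := ⟨fun x => x, fun _ _ => le_rfl⟩
  comp f g := ⟨fun x => g.toFun (f.toFun x),
    fun x y => (g.nonexpanding _ _).trans (f.nonexpanding x y)⟩

@[ext]
theorem hom_ext {M N : Met.{v}} {f g : M ⟶ N} (h : ∀ x, f.toFun x = g.toFun x) : f = g :=
  Hom.ext (funext h)

open scoped Classical in
/-- A set as a discrete space: all distances are `0` or `∞`. -/
noncomputable def discrete (S : Type v) : Met.{v} where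
  carrier := S
  str :=
    { edist := fun x y => if x = y then (0 : ℝ≥0∞) else ⊤
      edist_self := fun x => by simp
      edist_comm := fun x y => by simp only [eq_comm]
      edist_triangle := fun x y z => by
        by_cases h : x = y
        · subst h; simp
        · simp [h]
      eq_of_edist_eq_zero := fun {x y} h => by
        by_contra hne
        simp [hne] at h }

/-- Every map from a set to a space is nonexpanding on the discrete space. -/
def ofDiscrete {S : Type v} {M : Met.{v}} (i : S → M) : discrete S ⟶ M where
  toFun := i
  nonexpanding x y := by
    classical
    by_cases h : x = y
    · subst h; simp
    · exact le_top.trans_eq (if_neg h).symm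

/-- The one-point space. -/
noncomputable def point : Met.{v} := discrete PUnit.{v + 1}

/-- The metric reflection of a pseudometric space: points at distance `0` are identified. -/
noncomputable def reflection (X : Type v) [PseudoEMetricSpace X] : Met.{v} where
  carrier := SeparationQuotient X

/-- Nonexpanding maps between pseudometric spaces induce maps of the metric reflections. -/
noncomputable def reflectionMap {X Y : Type v} [PseudoEMetricSpace X] [PseudoEMetricSpace Y]
    (f : X → Y) (hf : ∀ x y, edist (f x) (f y) ≤ edist x y) : reflection X ⟶ reflection Y where
  toFun := SeparationQuotient.lift (fun x => SeparationQuotient.mk (f x)) (fun x y h =>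
    SeparationQuotient.mk_eq_mk.2 (EMetric.inseparable_iff.2
      (le_antisymm ((hf x y).trans (EMetric.inseparable_iff.1 h).le) zero_le)))
  nonexpanding x y := by
    induction x using Quotient.inductionOn with | _ x =>
    induction y using Quotient.inductionOn with | _ y =>
    exact hf x y

theorem reflectionMap_id (X : Type v) [PseudoEMetricSpace X] :
    reflectionMap (fun x : X => x) (fun _ _ => le_rfl) = 𝟙 (reflection X) :=
  Met.hom_ext fun x => Quotient.inductionOn x fun _ => rfl

theorem reflectionMap_comp {X Y Z : Type v} [PseudoEMetricSpace X] [PseudoEMetricSpace Y]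
    [PseudoEMetricSpace Z] (f : X → Y) (hf : ∀ x y, edist (f x) (f y) ≤ edist x y)
    (g : Y → Z) (hg : ∀ x y, edist (g x) (g y) ≤ edist x y) :
    reflectionMap (fun x => g (f x)) (fun x y => (hg _ _).trans (hf x y)) =
      reflectionMap f hf ≫ reflectionMap g hg :=
  Met.hom_ext fun x => Quotient.inductionOn x fun _ => rfl

end Met

/-! ### Metric-enriched categories -/

/-- A metric-enriched category: every hom-set carries an extended metric such that composition is
nonexpanding with respect to the addition metric. -/
class MetEnriched (K : Type u) [Category.{v} K] where
  homMetric (X Y : K) : EMetricSpace (X ⟶ Y)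
  edist_comp_le {X Y Z : K} (f f' : X ⟶ Y) (g g' : Y ⟶ Z) :
    edist (f ≫ g) (f' ≫ g') ≤ edist f f' + edist g g'

attribute [reducible, instance] MetEnriched.homMetric

/-- `Met` is enriched over itself by the supremum metric. -/
noncomputable instance : MetEnriched Met.{v} where
  homMetric M N :=
    { edist := fun f g => ⨆ x : M, edist (f.toFun x) (g.toFun x)
      edist_self := fun f => by simp
      edist_comm := fun f g => by simp only [edist_comm]
      edist_triangle := fun f g h => iSup_le fun x =>
        (edist_triangle _ (g.toFun x) _).trans (add_le_add
          (le_iSup (fun x => edist (f.toFun x) (g.toFun x)) x)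
          (le_iSup (fun x => edist (g.toFun x) (h.toFun x)) x))
      eq_of_edist_eq_zero := fun {f g} h => by
        ext x
        have h' : (⨆ x : M, edist (f.toFun x) (g.toFun x)) = 0 := h
        rw [ENNReal.iSup_eq_zero] at h'
        exact edist_eq_zero.1 (h' x) }
  edist_comp_le {M N P} f f' g g' := iSup_le fun x =>
    (edist_triangle _ (g.toFun (f'.toFun x)) _).trans (add_le_add
      ((g.nonexpanding _ _).trans (le_iSup (fun x => edist (f.toFun x) (f'.toFun x)) x))
      (le_iSup (fun y => edist (g.toFun y) (g'.toFun y)) (f'.toFun x)))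

/-- A full subcategory of an enriched category is enriched by the same distances. -/
instance {K : Type u} [Category.{v} K] [MetEnriched K] (P : ObjectProperty K) :
    MetEnriched P.FullSubcategory where
  homMetric X Y := EMetricSpace.induced (fun f : X ⟶ Y => f.hom)
    (fun _ _ h => ObjectProperty.hom_ext P h) (MetEnriched.homMetric X.obj Y.obj)
  edist_comp_le f f' g g' := MetEnriched.edist_comp_le f.hom f'.hom g.hom g'.hom

/-- The opposite of an enriched category. -/
instance {K : Type u} [Category.{v} K] [MetEnriched K] : MetEnriched Kᵒᵖ where
  homMetric X Y := EMetricSpace.induced (fun f : X ⟶ Y => f.unop)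
    Quiver.Hom.unop_inj (MetEnriched.homMetric Y.unop X.unop)
  edist_comp_le f f' g g' := by
    rw [add_comm]
    exact MetEnriched.edist_comp_le g.unop g'.unop f.unop f'.unop

/-- Natural transformations between functors into an enriched category carry the metric
`d(σ, τ) = sup_X d(σ_X, τ_X)`. -/
noncomputable instance {C : Type u₁} [Category.{v₁} C] {K : Type u} [Category.{v} K]
    [MetEnriched K] : MetEnriched (C ⥤ K) where
  homMetric F F' :=
    { edist := fun σ τ => ⨆ X : C, edist (σ.app X) (τ.app X)
      edist_self := fun σ => by simp
      edist_comm := fun σ τ => by simp only [edist_comm]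
      edist_triangle := fun σ τ ρ => iSup_le fun X =>
        (edist_triangle _ (τ.app X) _).trans (add_le_add
          (le_iSup (fun X => edist (σ.app X) (τ.app X)) X)
          (le_iSup (fun X => edist (τ.app X) (ρ.app X)) X))
      eq_of_edist_eq_zero := fun {σ τ} h => by
        ext X
        have h' : (⨆ X : C, edist (σ.app X) (τ.app X)) = 0 := h
        rw [ENNReal.iSup_eq_zero] at h'
        exact edist_eq_zero.1 (h' X) }
  edist_comp_le σ σ' τ τ' := iSup_le fun X =>
    (MetEnriched.edist_comp_le _ _ _ _).trans (add_le_add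
      (le_iSup (fun X => edist (σ.app X) (σ'.app X)) X)
      (le_iSup (fun X => edist (τ.app X) (τ'.app X)) X))

/-- Enriched functors are the locally nonexpanding ones. -/
def IsEnriched (C : Type u₁) [Category.{v₁} C] [MetEnriched C]
    (K : Type u) [Category.{v} K] [MetEnriched K] : ObjectProperty (C ⥤ K) :=
  fun F => ∀ ⦃X Y : C⦄ (f g : X ⟶ Y), edist (F.map f) (F.map g) ≤ edist f g

/-- The enriched category `[C, K]` of enriched functors and natural transformations. -/
abbrev EnrichedFunctor (C : Type u₁) [Category.{v₁} C] [MetEnriched C]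
    (K : Type u) [Category.{v} K] [MetEnriched K] :=
  (IsEnriched C K).FullSubcategory

section

variable {K : Type u} [Category.{v} K] [MetEnriched K]

/-- The hom-space `K(X, Y)`. -/
abbrev homSpace (X Y : K) : Met.{v} := ⟨X ⟶ Y⟩

/-- Precomposition `K(Y, Z) → K(X, Z)`. -/
def precomp {X Y : K} (f : X ⟶ Y) (Z : K) : homSpace Y Z ⟶ homSpace X Z where
  toFun g := f ≫ g
  nonexpanding g g' := by
    refine (MetEnriched.edist_comp_le (K := K) f f g g').trans_eq ?_
    rw [edist_self, zero_add]

/-- Postcomposition `K(X, Y) → K(X, Z)`. -/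
def postcomp (X : K) {Y Z : K} (g : Y ⟶ Z) : homSpace X Y ⟶ homSpace X Z where
  toFun f := f ≫ g
  nonexpanding f f' := by
    refine (MetEnriched.edist_comp_le (K := K) f f' g g).trans_eq ?_
    rw [edist_self, add_zero]

/-- The contravariant hom-functors `K(-, Z)`, as a functor of `Z`. -/
def homFunctor (K : Type u) [Category.{v} K] [MetEnriched K] : K ⥤ (Kᵒᵖ ⥤ Met.{v}) where
  obj Z :=
    { obj := fun X => homSpace X.unop Z
      map := fun f => precomp f.unop Z
      map_id := fun X => Met.hom_ext fun g => Category.id_comp (obj := K) g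
      map_comp := fun f f' => Met.hom_ext fun g => Category.assoc (obj := K) _ _ g }
  map h :=
    { app := fun X => postcomp X.unop h
      naturality := fun X Y f => Met.hom_ext fun g => Category.assoc (obj := K) f.unop g h }
  map_id Z := by
    ext X
    exact Category.comp_id (obj := K) _
  map_comp h h' := by
    ext X g
    exact (Category.assoc (obj := K) g h h').symm

/-! ### Weighted colimits -/

/-- The comparison map `K(C, X) → [Dᵒᵖ, Met](W, K(F -, X))` that the unit
`unit : W → K(F -, C)` induces by composition. -/
def weightedComparison {D : Type u₁} [Category.{v₁} D] {W : Dᵒᵖ ⥤ Met.{v}} {F : D ⥤ K} {C : K}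
    (unit : W ⟶ F.op ⋙ (homFunctor K).obj C) (X : K) (h : C ⟶ X) :
    W ⟶ F.op ⋙ (homFunctor K).obj X :=
  unit ≫ Functor.whiskerLeft F.op ((homFunctor K).map h)

/-- `C` with the unit `unit` is a colimit of `F : D ⥤ K` weighted by `W`: the comparison maps are
isomorphisms of metric spaces. All shapes `D` used here are discretely enriched, so that every
functor on `D` or `Dᵒᵖ` is enriched. -/
structure IsWeightedColimit {D : Type u₁} [Category.{v₁} D] (W : Dᵒᵖ ⥤ Met.{v}) (F : D ⥤ K)
    (C : K) (unit : W ⟶ F.op ⋙ (homFunctor K).obj C) : Prop where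
  bijective (X : K) : Function.Bijective (weightedComparison unit X)
  isometric (X : K) (h h' : C ⟶ X) :
    edist (weightedComparison unit X h) (weightedComparison unit X h') = edist h h'

/-- `K` has coequalizers of reflexive pairs; ordinary colimits are conical, that is, weighted by
the constant functor with the value the one-point space. -/
def HasReflexiveCoequalizers (K : Type u) [Category.{v} K] [MetEnriched K] : Prop :=
  ∀ (X Y : K) (f g : X ⟶ Y), IsReflexivePair f g →
    ∃ (C : K) (unit : (Functor.const _).obj Met.point ⟶
      (Limits.parallelPair f g).op ⋙ (homFunctor K).obj C),
      IsWeightedColimit _ (Limits.parallelPair f g) C unit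

end

/-! ### Basic diagrams and subregular epimorphisms -/

/-- Objects of the basic shape: all real numbers `ε ≥ 0`, and one more object `a`. -/
inductive Basic : Type
  | val (ε : ℝ≥0)
  | a

namespace Basic

/-- Morphisms of the basic shape: the chain of all `ε`, and two cocones with codomain `a`. -/
inductive Hom : Basic → Basic → Type
  | le {ε ε' : ℝ≥0} (h : ε ≤ ε') : Hom (val ε) (val ε')
  | l (ε : ℝ≥0) : Hom (val ε) a
  | r (ε : ℝ≥0) : Hom (val ε) a
  | idA : Hom a a

/-- Composition in the basic shape. -/
def Hom.comp : {x y z : Basic} → Hom x y → Hom y z → Hom x z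
  | _, _, _, .le h, .le h' => .le (h.trans h')
  | _, _, _, .le _, .l _ => .l _
  | _, _, _, .le _, .r _ => .r _
  | _, _, _, .l ε, .idA => .l ε
  | _, _, _, .r ε, .idA => .r ε
  | _, _, _, .idA, .idA => .idA

/-- The identities of the basic shape. -/
def Hom.id : (x : Basic) → Hom x x
  | .val _ => .le le_rfl
  | .a => .idA

instance : Category.{0} Basic where
  Hom := Hom
  id := Hom.id
  comp := Hom.comp
  id_comp f := by cases f <;> rfl
  comp_id f := by cases f <;> rfl
  assoc f g h := by cases f <;> cases g <;> cases h <;> rfl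

/-- The two-point pseudometric space `{0, 1}` with `d(0, 1) = ε`. -/
def TwoPoint (_ : ℝ≥0) : Type v := ULift.{v} Bool

noncomputable instance (ε : ℝ≥0) : PseudoEMetricSpace (TwoPoint.{v} ε) where
  edist x y := if ULift.down x = ULift.down y then 0 else (ε : ℝ≥0∞)
  edist_self x := by simp
  edist_comm x y := by simp only [eq_comm]
  edist_triangle x y z := by
    obtain ⟨x⟩ := x
    obtain ⟨y⟩ := y
    obtain ⟨z⟩ := z
    cases x <;> cases y <;> cases z <;> simp

/-- The point `0` (for `false`) or `1` (for `true`) of the two-point space. -/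
def TwoPoint.mk (ε : ℝ≥0) (b : Bool) : TwoPoint.{v} ε := ULift.up b

/-- The map of two-point spaces carried by the identity of `{0, 1}`. -/
def TwoPoint.map (ε' ε : ℝ≥0) (p : TwoPoint.{v} ε') : TwoPoint.{v} ε := TwoPoint.mk ε p.down

theorem TwoPoint.edist_map_le {ε ε' : ℝ≥0} (h : ε ≤ ε') (p q : TwoPoint.{v} ε') :
    edist (TwoPoint.map ε' ε p) (TwoPoint.map ε' ε q) ≤ edist p q := by
  change ite (p.down = q.down) 0 (ε : ℝ≥0∞) ≤ ite (p.down = q.down) 0 (ε' : ℝ≥0∞)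
  split_ifs
  · exact le_rfl
  · exact_mod_cast h

/-- The basic weight on objects: the one-point space at `a`, and `{0, 1}` with `d(0, 1) = ε` at
`ε`. For `ε = 0` the two points coincide, as they must in a metric space. -/
noncomputable def weightObj : Basic → Met.{v}
  | val ε => Met.reflection (TwoPoint.{v} ε)
  | a => Met.point

/-- The basic weight on morphisms: it is carried by the identity of `{0, 1}` on `ε ⟶ ε'`, and
picks out `0` on `l` and `1` on `r`. -/
noncomputable def weightMap : {x y : Basic} → Hom x y → (weightObj.{v} y ⟶ weightObj.{v} x)
  | _, _, .le (ε := ε) (ε' := ε') h =>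
    Met.reflectionMap (TwoPoint.map ε' ε) (TwoPoint.edist_map_le h)
  | _, _, .l ε =>
    Met.ofDiscrete (M := Met.reflection (TwoPoint.{v} ε))
      fun _ => SeparationQuotient.mk (TwoPoint.mk ε false)
  | _, _, .r ε =>
    Met.ofDiscrete (M := Met.reflection (TwoPoint.{v} ε))
      fun _ => SeparationQuotient.mk (TwoPoint.mk ε true)
  | _, _, .idA => 𝟙 _

theorem weightMap_id (x : Basic) : weightMap.{v} (Hom.id x) = 𝟙 (weightObj x) := by
  cases x with
  | val ε =>
    exact Met.reflectionMap_id (TwoPoint ε)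
  | a => rfl

theorem weightMap_comp {x y z : Basic} (f : Hom x y) (g : Hom y z) :
    weightMap.{v} (f.comp g) = weightMap g ≫ weightMap f := by
  cases f with
  | le h =>
    cases g with
    | le h' =>
      exact Met.reflectionMap_comp (TwoPoint.map _ _) (TwoPoint.edist_map_le h')
        (TwoPoint.map _ _) (TwoPoint.edist_map_le h)
    | l => exact Met.hom_ext fun _ => rfl
    | r => exact Met.hom_ext fun _ => rfl
  | l => cases g; exact (Category.id_comp _).symm
  | r => cases g; exact (Category.id_comp _).symm
  | idA => cases g; exact (Category.id_comp _).symm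

/-- The basic weight. -/
noncomputable def weight : Basicᵒᵖ ⥤ Met.{v} where
  obj x := weightObj x.unop
  map f := weightMap f.unop
  map_id x := weightMap_id x.unop
  map_comp f g := weightMap_comp g.unop f.unop

end Basic

section

variable {K : Type u} [Category.{v} K] [MetEnriched K]

/-- The colimit map `D a ⟶ C` of a basic colimit: the value of the unit at the only point of the
weight at `a`. -/
def colimitMap {D : Basic ⥤ K} {C : K}
    (unit : Basic.weight.{v} ⟶ D.op ⋙ (homFunctor K).obj C) : D.obj Basic.a ⟶ C :=
  (unit.app (op Basic.a)).toFun (PUnit.unit : PUnit.{v + 1})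

/-- A subregular epimorphism is the colimit map of some basic diagram `D`, that is, of the colimit
of `D` weighted by the basic weight. -/
inductive IsSubregularEpi : {X Y : K} → (X ⟶ Y) → Prop
  | mk (D : Basic ⥤ K) (C : K) (unit : Basic.weight.{v} ⟶ D.op ⋙ (homFunctor K).obj C)
      (h : IsWeightedColimit Basic.weight.{v} D C unit) : IsSubregularEpi (colimitMap unit)

/-! ### Tensors, copowers and generators -/

/-- The map `K(T, X) → Met(M, K(G, X))` induced by `η : M → K(G, T)`. -/
def tensorComparison {M : Met.{v}} {G T : K} (η : M ⟶ homSpace G T) (X : K) (h : T ⟶ X) :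
    M ⟶ homSpace G X :=
  η ≫ postcomp G h

/-- `T` with the unit `η : M → K(G, T)` is a tensor product `M ⊗ G`: composition with `η` is an
isomorphism of metric spaces between `K(T, X)` and `Met(M, K(G, X))`, for every `X`. -/
structure IsTensor (M : Met.{v}) (G T : K) (η : M ⟶ homSpace G T) : Prop where
  bijective (X : K) : Function.Bijective (tensorComparison η X)
  isometric (X : K) (h h' : T ⟶ X) :
    edist (tensorComparison η X h) (tensorComparison η X h') = edist h h'

/-- `G` has tensors: `M ⊗ G` exists for all spaces `M`. -/
def HasTensors (G : K) : Prop :=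
  ∀ M : Met.{v}, ∃ (T : K) (η : M ⟶ homSpace G T), IsTensor M G T η

/-- `C` with the injections `i` is the copower of `G` indexed by the set `S`: the tensor product
of the discrete space `S` with `G`. -/
def IsCopower (S : Type v) (G C : K) (i : S → (G ⟶ C)) : Prop :=
  IsTensor (Met.discrete S) G C (Met.ofDiscrete (M := homSpace G C) i)

/-- `G` is abstractly finite: every morphism from `G` to a copower of `G` factorizes through a
finite subcopower. -/
def IsAbstractlyFinite (G : K) : Prop :=
  ∀ (S : Type v) (C : K) (i : S → (G ⟶ C)), IsCopower S G C i → ∀ f : G ⟶ C,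
    ∃ (S' : Set S) (C' : K) (i' : S' → (G ⟶ C')) (j : C' ⟶ C) (f' : G ⟶ C'),
      S'.Finite ∧ IsCopower S' G C' i' ∧ (∀ s : S', i' s ≫ j = i s) ∧ f' ≫ j = f

/-- `G` is a subregular projective: morphisms from `G` factorize through all subregular
epimorphisms. -/
def IsSubregularProjective (G : K) : Prop :=
  ∀ ⦃X Y : K⦄ (e : X ⟶ Y), IsSubregularEpi e → ∀ f : G ⟶ Y, ∃ g : G ⟶ X, g ≫ e = f

/-- `G` is a subregular generator: it has tensors, and for every object `X` the evaluation
morphism `K(G, X) ⊗ G ⟶ X` (the one that corresponds to the identity of `K(G, X)`) is a subregular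
epimorphism. -/
def IsSubregularGenerator (G : K) : Prop :=
  HasTensors G ∧
    ∀ (X T : K) (η : homSpace G X ⟶ homSpace G T), IsTensor (homSpace G X) G T η →
      ∀ e : T ⟶ X, tensorComparison η X e = 𝟙 (homSpace G X) → IsSubregularEpi e

/-- A subvarietal generator: an abstractly finite subregular projective which is a subregular
generator. -/
def IsSubvarietalGenerator (G : K) : Prop :=
  IsSubregularGenerator G ∧ IsAbstractlyFinite G ∧ IsSubregularProjective G

/-- The objects which are finite copowers `n ⊗ G`, for `n ∈ ℕ`, of `G`. -/
def IsFiniteCopower (G : K) : ObjectProperty K :=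
  fun C => ∃ (n : ℕ) (i : ULift.{v} (Fin n) → (G ⟶ C)), IsCopower (ULift.{v} (Fin n)) G C i

/-! ### Density -/

/-- The restricted Yoneda functor `E : K ⥤ [Aᵒᵖ, Met]` of the full subcategory `A` on the objects
with the property `P`; it assigns to `X` the restriction of `K(-, X)` to `Aᵒᵖ`. -/
def restrictedYoneda (P : ObjectProperty K) :
    K ⥤ EnrichedFunctor P.FullSubcategoryᵒᵖ Met.{v} :=
  (IsEnriched P.FullSubcategoryᵒᵖ Met.{v}).lift
    (homFunctor K ⋙ (Functor.whiskeringLeft _ _ _).obj P.ι.op)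
    (fun Z X _ f g => iSup_le fun (h : X.unop.obj ⟶ Z) =>
      (MetEnriched.edist_comp_le f.unop.hom g.unop.hom h h).trans_eq
        ((congrArg _ (edist_self h)).trans (add_zero _)))

/-- The full subcategory on the objects with the property `P` is dense: the restricted Yoneda
functor is faithful in the enriched sense (it preserves the distances of parallel pairs) and
full. -/
def IsDenseSubcategory (P : ObjectProperty K) : Prop :=
  (∀ ⦃X Y : K⦄ (f f' : X ⟶ Y),
    edist f f' = edist ((restrictedYoneda P).map f) ((restrictedYoneda P).map f')) ∧
  (restrictedYoneda P).Full

end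

end MetCat

/-! Let `T` be the tensor product `K(G, X) ⊗ G` and `e : T ⟶ X` the evaluation. A natural
transformation `σ : E X ⟶ E Y` has a component `σ_G : K(G, X) → K(G, Y)`, which corresponds to a
morphism `f : T ⟶ Y`. A morphism `q : G ⟶ T` lifts along the canonical subregular epimorphism
`∐_{K(G, X)} G ⟶ T`, and the lift factorizes through a finite subcopower, where naturality of `σ`
applies; hence `q ≫ f = σ_G (q ≫ e)`. As `σ_G` is nonexpanding and morphisms out of `G` detect
distances, `f` is a cocone on the basic diagram of which `e` is the colimit map, so that `f = e ≫ g`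
for some `g : X ⟶ Y`. Then `E g` and `σ` agree at `G`, and therefore everywhere. -/

namespace MetCat

/-- The map out of the metric reflection induced by a nonexpanding map into a metric space. -/
noncomputable def Met.reflectionLift {X : Type v} [PseudoEMetricSpace X] {N : Met.{v}}
    (f : X → N) (hf : ∀ x y, edist (f x) (f y) ≤ edist x y) : Met.reflection X ⟶ N where
  toFun := SeparationQuotient.lift f fun x y h =>
    edist_le_zero.1 ((hf x y).trans (EMetric.inseparable_iff.1 h).le)
  nonexpanding := by
    rintro ⟨x⟩ ⟨y⟩
    exact hf x y

section

variable {K : Type u} [Category.{v} K] [MetEnriched K]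

theorem edist_comp_left_le {X Y Z : K} (f : X ⟶ Y) (g g' : Y ⟶ Z) :
    edist (f ≫ g) (f ≫ g') ≤ edist g g' :=
  (precomp f Z).nonexpanding g g'

theorem edist_iso_hom_comp {X Y Z : K} (f : X ≅ Y) (g g' : Y ⟶ Z) :
    edist (f.hom ≫ g) (f.hom ≫ g') = edist g g' := by
  refine (edist_comp_left_le _ _ _).antisymm ?_
  simpa only [Iso.inv_hom_id_assoc] using edist_comp_left_le f.inv (f.hom ≫ g) (f.hom ≫ g')

namespace Basic

/-- The two morphisms `ε ⟶ a` of the basic shape: `l` for `false` and `r` for `true`. -/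
def leg (ε : ℝ≥0) : Bool → (val ε ⟶ a)
  | false => Hom.l ε
  | true => Hom.r ε

theorem le_comp_leg {ε ε' : ℝ≥0} (h : ε ≤ ε') (b : Bool) :
    (Hom.le h : val ε ⟶ val ε') ≫ leg ε' b = leg ε b := by
  cases b <;> rfl

/-- The points `0` (for `false`) and `1` (for `true`) of the basic weight at `ε`. -/
noncomputable def pt (ε : ℝ≥0) (b : Bool) : weight.{v}.obj (op (val ε)) :=
  (SeparationQuotient.mk (TwoPoint.mk ε b) : SeparationQuotient (TwoPoint.{v} ε))

theorem pt_surjective (ε : ℝ≥0) : Function.Surjective (pt.{v} ε) := by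
  rintro ⟨w⟩
  exact ⟨w.down, rfl⟩

theorem edist_pt (ε : ℝ≥0) : edist (pt.{v} ε false) (pt ε true) = ε :=
  (SeparationQuotient.edist_mk _ _).trans (if_neg Bool.false_ne_true)

/-- The map out of the value of the basic weight at `ε` which is given by two points at distance
at most `ε`. -/
noncomputable def weightLift {ε : ℝ≥0} {N : Met.{v}} (x : Bool → N)
    (hx : edist (x false) (x true) ≤ ε) : weight.{v}.obj (op (val ε)) ⟶ N :=
  Met.reflectionLift (fun p : TwoPoint.{v} ε => x p.down) (by
    rintro ⟨p⟩ ⟨q⟩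
    change _ ≤ ite (p = q) 0 (ε : ℝ≥0∞)
    cases p <;> cases q
    · simp
    · simpa using hx
    · simpa [edist_comm] using hx
    · simp)

/-- The condition on a morphism out of `D a` to be the `a`-component of a cocone on `D` weighted
by the basic weight. -/
def IsCoconeMap (D : Basic ⥤ K) {Z : K} (f : D.obj a ⟶ Z) : Prop :=
  ∀ ε : ℝ≥0, edist (D.map (leg ε false) ≫ f) (D.map (leg ε true) ≫ f) ≤ ε

/-- The weighted cocone with a given `a`-component. -/
noncomputable def cocone (D : Basic ⥤ K) {Z : K} (f : D.obj a ⟶ Z) (hf : IsCoconeMap D f) :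
    weight.{v} ⟶ D.op ⋙ (homFunctor K).obj Z where
  app
    | ⟨val ε⟩ => weightLift (N := homSpace (D.obj (val ε)) Z) (fun b => D.map (leg ε b) ≫ f) (hf ε)
    | ⟨a⟩ => Met.ofDiscrete (M := homSpace (D.obj a) Z) fun _ => f
  naturality := by
    rintro ⟨x⟩ ⟨y⟩ ⟨k⟩
    change Hom y x at k
    cases k with
    | @le ε ε' h =>
      refine Met.hom_ext fun w => ?_
      obtain ⟨b, rfl⟩ := pt_surjective _ w
      change D.map (leg ε b) ≫ f = D.map _ ≫ D.map (leg ε' b) ≫ f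
      rw [← le_comp_leg h, D.map_comp, Category.assoc]
      rfl
    | l ε => rfl
    | r ε => rfl
    | idA =>
      refine Met.hom_ext fun _ => ?_
      change f = D.map (𝟙 a) ≫ f
      rw [D.map_id, Category.id_comp]

section

variable {D : Basic ⥤ K} {Z : K}

theorem app_pt (τ : weight.{v} ⟶ D.op ⋙ (homFunctor K).obj Z) (ε : ℝ≥0) (b : Bool) :
    (τ.app (op (val ε))).toFun (pt ε b) = D.map (leg ε b) ≫ colimitMap τ := by
  have naturality := congrFun (congrArg Met.Hom.toFun (τ.naturality (leg ε b).op))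
    (PUnit.unit : PUnit.{v + 1})
  cases b <;> exact naturality

theorem isCoconeMap_colimitMap (τ : weight.{v} ⟶ D.op ⋙ (homFunctor K).obj Z) :
    IsCoconeMap D (colimitMap τ) := fun ε => by
  rw [← app_pt, ← app_pt, ← edist_pt.{v} ε]
  exact (τ.app (op (val ε))).nonexpanding _ _

theorem edist_colimitMap (τ τ' : weight.{v} ⟶ D.op ⋙ (homFunctor K).obj Z) :
    edist (colimitMap τ) (colimitMap τ') = edist τ τ' := by
  apply le_antisymm
  · exact (le_iSup (fun w => edist ((τ.app (op a)).toFun w) ((τ'.app (op a)).toFun w))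
      (PUnit.unit : PUnit.{v + 1})).trans
      (le_iSup (fun x => edist (τ.app x) (τ'.app x)) (op a))
  · refine iSup_le fun ⟨x⟩ => iSup_le fun w => ?_
    cases x with
    | val ε =>
      obtain ⟨b, rfl⟩ := pt_surjective _ w
      rw [app_pt, app_pt]
      exact edist_comp_left_le _ _ _
    | a => exact le_rfl

theorem colimitMap_injective :
    Function.Injective (colimitMap (D := D) (C := Z)) := fun τ τ' h => by
  rw [← edist_eq_zero, ← edist_colimitMap, h, edist_self]

theorem isWeightedColimit_weight_iff (unit : weight.{v} ⟶ D.op ⋙ (homFunctor K).obj Z) :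
    IsWeightedColimit weight.{v} D Z unit ↔
      (∀ (X : K) (h h' : Z ⟶ X),
        edist (colimitMap unit ≫ h) (colimitMap unit ≫ h') = edist h h') ∧
      ∀ (X : K) (f : D.obj a ⟶ X), IsCoconeMap D f → ∃ h, colimitMap unit ≫ h = f := by
  have edist_comparison (X : K) (h h' : Z ⟶ X) :
      edist (weightedComparison unit X h) (weightedComparison unit X h') =
        edist (colimitMap unit ≫ h) (colimitMap unit ≫ h') :=
    (edist_colimitMap _ _).symm
  constructor
  · refine fun hC => ⟨fun X h h' => ?_, fun X f hf => ?_⟩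
    · rw [← edist_comparison, hC.isometric]
    · obtain ⟨h, hh⟩ := (hC.bijective X).2 (cocone D f hf)
      exact ⟨h, congrArg colimitMap hh⟩
  · rintro ⟨isometric, exists_desc⟩
    refine ⟨fun X => ⟨fun h h' hh => ?_, fun τ => ?_⟩, fun X h h' => ?_⟩
    · rw [← edist_eq_zero, ← isometric, ← edist_comparison, hh, edist_self]
    · obtain ⟨h, hh⟩ := exists_desc X _ (isCoconeMap_colimitMap τ)
      exact ⟨h, colimitMap_injective hh⟩
    · rw [edist_comparison, isometric]

end

end Basic

theorem isSubregularEpi_of_isCoconeMap (D : Basic ⥤ K) {C : K} {e : D.obj Basic.a ⟶ C}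
    (he : Basic.IsCoconeMap D e)
    (isometric : ∀ (X : K) (h h' : C ⟶ X), edist (e ≫ h) (e ≫ h') = edist h h')
    (exists_desc : ∀ (X : K) (f : D.obj Basic.a ⟶ X), Basic.IsCoconeMap D f → ∃ h, e ≫ h = f) :
    IsSubregularEpi e :=
  .mk D C (Basic.cocone D e he)
    ((Basic.isWeightedColimit_weight_iff _).2 ⟨isometric, exists_desc⟩)

namespace IsSubregularEpi

variable {X Y Z : K} {e : X ⟶ Y}

theorem edist_comp (he : IsSubregularEpi e) (h h' : Y ⟶ Z) :
    edist (e ≫ h) (e ≫ h') = edist h h' := by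
  obtain ⟨D, _, unit, hC⟩ := he
  exact ((Basic.isWeightedColimit_weight_iff unit).1 hC).1 Z h h'

theorem exists_comp_eq (he : IsSubregularEpi e) (f : X ⟶ Z)
    (hf : ∀ (W : K) (p q : W ⟶ X), edist (p ≫ f) (q ≫ f) ≤ edist (p ≫ e) (q ≫ e)) :
    ∃ g : Y ⟶ Z, e ≫ g = f := by
  obtain ⟨D, _, unit, hC⟩ := he
  exact ((Basic.isWeightedColimit_weight_iff unit).1 hC).2 Z f fun ε =>
    (hf _ _ _).trans (Basic.isCoconeMap_colimitMap unit ε)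

end IsSubregularEpi

namespace IsTensor

variable {M : Met.{v}} {G T : K} {η : M ⟶ homSpace G T}

theorem exists_desc (hT : IsTensor M G T η) {X : K} (φ : M ⟶ homSpace G X) :
    ∃ h : T ⟶ X, ∀ m, η.toFun m ≫ h = φ.toFun m := by
  obtain ⟨h, rfl⟩ := (hT.bijective X).2 φ
  exact ⟨h, fun _ => rfl⟩

theorem edist_eq (hT : IsTensor M G T η) {X : K} (h h' : T ⟶ X) :
    edist h h' = ⨆ m, edist (η.toFun m ≫ h) (η.toFun m ≫ h') :=
  (hT.isometric X h h').symm

theorem hom_ext (hT : IsTensor M G T η) {X : K} {h h' : T ⟶ X}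
    (w : ∀ m, η.toFun m ≫ h = η.toFun m ≫ h') : h = h' :=
  (hT.bijective X).1 (Met.hom_ext w)

theorem of_iso (hT : IsTensor M G T η) {M' : Met.{v}} (σ : M' ≅ M) :
    IsTensor M' G T (σ.hom ≫ η) where
  bijective X := σ.homFromEquiv.symm.bijective.comp (hT.bijective X)
  isometric X h h' := (edist_iso_hom_comp σ _ _).trans (hT.isometric X h h')

end IsTensor

/-- A bijection of sets, as an isomorphism of discrete spaces. -/
noncomputable def Met.discreteIso {S S' : Type v} (σ : S ≃ S') :
    Met.discrete S ≅ Met.discrete S' where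
  hom := Met.ofDiscrete (M := Met.discrete S') σ
  inv := Met.ofDiscrete (M := Met.discrete S) σ.symm
  hom_inv_id := Met.hom_ext σ.symm_apply_apply
  inv_hom_id := Met.hom_ext σ.apply_symm_apply

namespace IsCopower

variable {S : Type v} {G C : K} {i : S → (G ⟶ C)}

theorem exists_desc (hC : IsCopower S G C i) {X : K} (f : S → (G ⟶ X)) :
    ∃ h : C ⟶ X, ∀ s, i s ≫ h = f s :=
  IsTensor.exists_desc hC (Met.ofDiscrete (M := homSpace G X) f)

theorem edist_eq (hC : IsCopower S G C i) {X : K} (h h' : C ⟶ X) :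
    edist h h' = ⨆ s, edist (i s ≫ h) (i s ≫ h') :=
  IsTensor.edist_eq hC h h'

theorem hom_ext (hC : IsCopower S G C i) {X : K} {h h' : C ⟶ X}
    (w : ∀ s, i s ≫ h = i s ≫ h') : h = h' :=
  IsTensor.hom_ext hC w

theorem reindex (hC : IsCopower S G C i) {S' : Type v} (σ : S' ≃ S) :
    IsCopower S' G C (i ∘ σ) :=
  IsTensor.of_iso hC (Met.discreteIso σ)

theorem isFiniteCopower [Finite S] (hC : IsCopower S G C i) : IsFiniteCopower G C :=
  ⟨Nat.card S, _, hC.reindex (Equiv.ulift.trans (Finite.equivFin S).symm)⟩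

end IsCopower

theorem isCopower_id (S : Type v) [Unique S] (G : K) : IsCopower S G G fun _ => 𝟙 G where
  bijective X := by
    refine ⟨fun h h' hh => ?_, fun φ => ⟨φ.toFun (default : S), Met.hom_ext fun s => ?_⟩⟩
    · have comp_eq : 𝟙 G ≫ h = 𝟙 G ≫ h' :=
        congrFun (congrArg Met.Hom.toFun hh) (default : S)
      simpa only [Category.id_comp] using comp_eq
    · exact (Category.id_comp (obj := K) _).trans (congrArg φ.toFun (Unique.default_eq (α := S) s))
  isometric X h h' := by
    change (⨆ _ : S, edist (𝟙 G ≫ h) (𝟙 G ≫ h')) = _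
    rw [ciSup_const, Category.id_comp, Category.id_comp]

theorem isFiniteCopower_self (G : K) : IsFiniteCopower G G :=
  (isCopower_id PUnit G).isFiniteCopower

namespace HasTensors

variable {G : K} (hG : HasTensors G) {S : Type v} {X Y : K}

/-- A choice of the copower of `G` indexed by `S`. -/
noncomputable def copower (S : Type v) : K :=
  (hG (Met.discrete S)).choose

/-- The injections of the chosen copower. -/
noncomputable def ι (s : S) : G ⟶ hG.copower S :=
  (hG (Met.discrete S)).choose_spec.choose.toFun s

theorem isCopower (S : Type v) : IsCopower S G (hG.copower S) hG.ι :=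
  (hG (Met.discrete S)).choose_spec.choose_spec

/-- The morphism out of the chosen copower which is given by a family of morphisms. -/
noncomputable def desc (f : S → (G ⟶ X)) : hG.copower S ⟶ X :=
  ((hG.isCopower S).exists_desc f).choose

@[simp]
theorem ι_desc (f : S → (G ⟶ X)) (s : S) : hG.ι s ≫ hG.desc f = f s :=
  ((hG.isCopower S).exists_desc f).choose_spec s

@[simp]
theorem ι_desc_assoc (f : S → (G ⟶ X)) (s : S) (g : X ⟶ Y) :
    hG.ι s ≫ hG.desc f ≫ g = f s ≫ g := by
  rw [← Category.assoc, ι_desc]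

/-- The copowers of `G`, as a functor of the index set. -/
noncomputable def copowerFunctor : Type v ⥤ K where
  obj S := hG.copower S
  map f := hG.desc fun s => hG.ι (f s)
  map_id S := (hG.isCopower S).hom_ext fun s => by simp
  map_comp f g := (hG.isCopower _).hom_ext fun s => by simp

end HasTensors

/-- The pairs of points at distance at most `ε`. -/
abbrev ClosePairs (M : Met.{v}) (ε : ℝ≥0) : Type v :=
  {p : M × M // edist p.1 p.2 ≤ ε}

/-- The index sets of the canonical presentation of `M ⊗ G` by copowers of `G`: the sets
`ClosePairs M ε`, with the two projections to the set of points. -/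
def closePairsDiagram (M : Met.{v}) : Basic ⥤ Type v where
  obj
    | .val ε => ClosePairs M ε
    | .a => M
  map
    | Basic.Hom.le h => TypeCat.ofHom fun p => ⟨p.1, p.2.trans (ENNReal.coe_le_coe.2 h)⟩
    | Basic.Hom.l _ => TypeCat.ofHom fun p => p.1.1
    | Basic.Hom.r _ => TypeCat.ofHom fun p => p.1.2
    | Basic.Hom.idA => 𝟙 _
  map_id x := by cases x <;> rfl
  map_comp {x y z} k k' := by
    change Basic.Hom x y at k
    change Basic.Hom y z at k'
    cases k <;> cases k' <;> rfl

namespace HasTensors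

variable {G : K} (hG : HasTensors G) (M : Met.{v})

/-- The basic diagram which presents `M ⊗ G` by copowers of `G`. -/
noncomputable def presentation : Basic ⥤ K :=
  closePairsDiagram M ⋙ hG.copowerFunctor

theorem isCoconeMap_presentation_iff {X : K} (f : hG.copower M ⟶ X) :
    Basic.IsCoconeMap (hG.presentation M) f ↔
      ∀ m m' : M, edist (hG.ι m ≫ f) (hG.ι m' ≫ f) ≤ edist m m' := by
  have edist_legs (ε : ℝ≥0) :
      edist ((hG.presentation M).map (Basic.leg ε false) ≫ f)
          ((hG.presentation M).map (Basic.leg ε true) ≫ f) =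
        ⨆ p : ClosePairs M ε, edist (hG.ι p.1.1 ≫ f) (hG.ι p.1.2 ≫ f) :=
    ((hG.isCopower (ClosePairs M ε)).edist_eq _ _).trans (iSup_congr fun p =>
      congrArg₂ edist (hG.ι_desc_assoc (fun p : ClosePairs M ε => hG.ι p.1.1) p f)
        (hG.ι_desc_assoc (fun p : ClosePairs M ε => hG.ι p.1.2) p f))
  simp only [Basic.IsCoconeMap, edist_legs, iSup_le_iff, Subtype.forall, Prod.forall]
  refine ⟨fun hf m m' => ?_, fun hf ε m m' hm => (hf m m').trans hm⟩
  obtain hm | hm := eq_or_ne (edist m m') ⊤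
  · exact hm ▸ le_top
  · rw [← ENNReal.coe_toNNReal hm]
    exact hf _ m m' (ENNReal.coe_toNNReal hm).ge

end HasTensors

theorem IsTensor.isSubregularEpi_desc {M : Met.{v}} {G T : K} {η : M ⟶ homSpace G T}
    (hT : IsTensor M G T η) (hG : HasTensors G) : IsSubregularEpi (hG.desc η.toFun) := by
  refine isSubregularEpi_of_isCoconeMap (hG.presentation M) ?_ (fun X h h' => ?_) fun X f hf => ?_
  · rw [hG.isCoconeMap_presentation_iff]
    simpa only [HasTensors.ι_desc] using η.nonexpanding
  · refine ((hG.isCopower M).edist_eq _ _).trans ?_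
    rw [hT.edist_eq]
    exact iSup_congr fun m => congrArg₂ edist (hG.ι_desc_assoc _ m h) (hG.ι_desc_assoc _ m h')
  · replace hf := (hG.isCoconeMap_presentation_iff M f).1 hf
    obtain ⟨h, hh⟩ := hT.exists_desc (X := X) ⟨fun m => hG.ι m ≫ f, hf⟩
    exact ⟨h, (hG.isCopower M).hom_ext fun m => (hG.ι_desc_assoc _ m h).trans (hh m)⟩

namespace IsSubregularGenerator

variable {G X Y : K}

theorem exists_eval (hG : IsSubregularGenerator G) (X : K) :
    ∃ (T : K) (η : homSpace G X ⟶ homSpace G T) (e : T ⟶ X), IsTensor (homSpace G X) G T η ∧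
      IsSubregularEpi e ∧ ∀ p : G ⟶ X, η.toFun p ≫ e = p := by
  obtain ⟨T, η, hT⟩ := hG.1 (homSpace G X)
  obtain ⟨e, he⟩ := (hT.bijective X).2 (𝟙 (homSpace G X))
  exact ⟨T, η, e, hT, hG.2 X T η hT e he, congrFun (congrArg Met.Hom.toFun he)⟩

theorem edist_eq (hG : IsSubregularGenerator G) (f f' : X ⟶ Y) :
    edist f f' = ⨆ p : G ⟶ X, edist (p ≫ f) (p ≫ f') := by
  obtain ⟨T, η, e, hT, he, hη⟩ := hG.exists_eval X
  rw [← he.edist_comp, hT.edist_eq]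
  refine iSup_congr fun p => ?_
  rw [← Category.assoc, ← Category.assoc, hη]

theorem hom_ext (hG : IsSubregularGenerator G) {f f' : X ⟶ Y}
    (w : ∀ p : G ⟶ X, p ≫ f = p ≫ f') : f = f' := by
  simp only [← edist_eq_zero, hG.edist_eq f f', w, edist_self, ENNReal.iSup_zero]

theorem exists_comp_eq (hG : IsSubregularGenerator G) {T : K} {e : T ⟶ X}
    (he : IsSubregularEpi e) (f : T ⟶ Y) (φ : homSpace G X ⟶ homSpace G Y)
    (hf : ∀ q : G ⟶ T, q ≫ f = φ.toFun (q ≫ e)) : ∃ g : X ⟶ Y, e ≫ g = f := by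
  refine he.exists_comp_eq f fun W p q => ?_
  rw [hG.edist_eq]
  refine iSup_le fun k => ?_
  calc edist (k ≫ p ≫ f) (k ≫ q ≫ f)
      = edist (φ.toFun (k ≫ p ≫ e)) (φ.toFun (k ≫ q ≫ e)) := by
        simp only [← Category.assoc, hf]
    _ ≤ edist (k ≫ p ≫ e) (k ≫ q ≫ e) := φ.nonexpanding _ _
    _ ≤ edist (p ≫ e) (q ≫ e) := edist_comp_left_le k _ _

end IsSubregularGenerator

theorem IsSubvarietalGenerator.exists_factorization {G : K} (hG : IsSubvarietalGenerator G)
    {M : Met.{v}} {T : K} {η : M ⟶ homSpace G T} (hT : IsTensor M G T η) (q : G ⟶ T) :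
    ∃ (S : Set M) (C : K) (i : S → (G ⟶ C)) (q' : G ⟶ C) (j : C ⟶ T), S.Finite ∧
      IsCopower S G C i ∧ (∀ s : S, i s ≫ j = η.toFun s) ∧ q' ≫ j = q := by
  obtain ⟨⟨tensors, -⟩, finite, projective⟩ := hG
  obtain ⟨q₀, rfl⟩ := projective _ (hT.isSubregularEpi_desc tensors) q
  obtain ⟨S, C, i, j, q', hS, hC, hj, rfl⟩ := finite M _ _ (tensors.isCopower M) q₀
  refine ⟨S, C, i, q', j ≫ tensors.desc η.toFun, hS, hC, fun s => ?_, (Category.assoc ..).symm⟩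
  rw [← Category.assoc, hj, tensors.ι_desc]

section RestrictedYoneda

variable {P : ObjectProperty K} {G X Y : K}

/-- The component at an object `A` of `P` of a morphism between restricted hom-functors. -/
def homComponent (σ : (restrictedYoneda P).obj X ⟶ (restrictedYoneda P).obj Y) {A : K}
    (hA : P A) : homSpace A X ⟶ homSpace A Y :=
  σ.hom.app (op ⟨A, hA⟩)

theorem homComponent_comp (σ : (restrictedYoneda P).obj X ⟶ (restrictedYoneda P).obj Y)
    {A B : K} (hA : P A) (hB : P B) (k : A ⟶ B) (p : B ⟶ X) :
    (homComponent σ hA).toFun (k ≫ p) = k ≫ (homComponent σ hB).toFun p :=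
  let k' : (⟨A, hA⟩ : P.FullSubcategory) ⟶ ⟨B, hB⟩ := ObjectProperty.homMk k
  congrFun (congrArg Met.Hom.toFun (σ.hom.naturality k'.op)) p

theorem edist_map_restrictedYoneda_eq_iSup (f f' : X ⟶ Y) :
    edist ((restrictedYoneda P).map f) ((restrictedYoneda P).map f') =
      ⨆ A : P.FullSubcategoryᵒᵖ, ⨆ p : A.unop.obj ⟶ X, edist (p ≫ f) (p ≫ f') :=
  rfl

theorem IsSubregularGenerator.edist_map_restrictedYoneda (hG : IsSubregularGenerator G)
    (hP : P G) (f f' : X ⟶ Y) :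
    edist ((restrictedYoneda P).map f) ((restrictedYoneda P).map f') = edist f f' := by
  rw [edist_map_restrictedYoneda_eq_iSup]
  apply le_antisymm
  · exact iSup_le fun A => iSup_le fun p => edist_comp_left_le p f f'
  · rw [hG.edist_eq]
    exact le_iSup (fun A : P.FullSubcategoryᵒᵖ => ⨆ p : A.unop.obj ⟶ X, edist (p ≫ f) (p ≫ f'))
      (op ⟨G, hP⟩)

theorem IsSubregularGenerator.map_restrictedYoneda_eq (hG : IsSubregularGenerator G) (hP : P G)
    (σ : (restrictedYoneda P).obj X ⟶ (restrictedYoneda P).obj Y) (g : X ⟶ Y)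
    (hg : ∀ p : G ⟶ X, p ≫ g = (homComponent σ hP).toFun p) : (restrictedYoneda P).map g = σ := by
  refine ObjectProperty.hom_ext _ (NatTrans.ext (funext fun ⟨A, hA⟩ => Met.hom_ext fun p => ?_))
  change A ⟶ X at p
  change p ≫ g = (homComponent σ hA).toFun p
  refine hG.hom_ext fun k => ?_
  rw [← homComponent_comp σ hP hA, ← Category.assoc, hg]

theorem IsSubvarietalGenerator.comp_eq_homComponent (hG : IsSubvarietalGenerator G)
    (hP : IsFiniteCopower G ≤ P) (hPG : P G)
    (σ : (restrictedYoneda P).obj X ⟶ (restrictedYoneda P).obj Y)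
    {M : Met.{v}} {T : K} {η : M ⟶ homSpace G T} (hT : IsTensor M G T η) (e : T ⟶ X) (f : T ⟶ Y)
    (hf : ∀ m, η.toFun m ≫ f = (homComponent σ hPG).toFun (η.toFun m ≫ e)) (q : G ⟶ T) :
    q ≫ f = (homComponent σ hPG).toFun (q ≫ e) := by
  obtain ⟨S, C, i, q, j, hS, hC, hj, rfl⟩ := hG.exists_factorization hT q
  have : Finite S := hS
  have hPC : P C := hP C hC.isFiniteCopower
  have comp_eq_on_copower : j ≫ f = (homComponent σ hPC).toFun (j ≫ e) :=
    hC.hom_ext fun s => by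
      rw [← homComponent_comp σ hPG hPC, ← Category.assoc, ← Category.assoc, hj, hf]
  rw [Category.assoc, Category.assoc, homComponent_comp σ hPG hPC, comp_eq_on_copower]

theorem IsSubvarietalGenerator.full_restrictedYoneda (hG : IsSubvarietalGenerator G)
    (hP : IsFiniteCopower G ≤ P) : (restrictedYoneda P).Full where
  map_surjective {X Y} σ := by
    have hPG : P G := hP G (isFiniteCopower_self G)
    obtain ⟨T, η, e, hT, he, hη⟩ := hG.1.exists_eval X
    obtain ⟨f, hf⟩ := hT.exists_desc (homComponent σ hPG)
    have comp_f : ∀ q : G ⟶ T, q ≫ f = (homComponent σ hPG).toFun (q ≫ e) :=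
      hG.comp_eq_homComponent hP hPG σ hT e f fun p => by rw [hη, hf]
    obtain ⟨g, rfl⟩ := hG.1.exists_comp_eq he f (homComponent σ hPG) comp_f
    refine ⟨g, hG.1.map_restrictedYoneda_eq hPG σ g fun p => ?_⟩
    rw [← hf, ← Category.assoc, hη]

end RestrictedYoneda

end

end MetCat

theorem theoremT_general {K : Type u} [Category.{v} K] [MetCat.MetEnriched K] {G : K}
    (hG : MetCat.IsSubvarietalGenerator G) {P : ObjectProperty K}
    (hP : MetCat.IsFiniteCopower G ≤ P) : MetCat.IsDenseSubcategory P :=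
  have hPG : P G := hP G (MetCat.isFiniteCopower_self G)
  ⟨fun _ _ f f' => (hG.1.edist_map_restrictedYoneda hPG f f').symm, hG.full_restrictedYoneda hP⟩

theorem theoremT {K : Type u} [Category.{v} K] [MetCat.MetEnriched K]
    (hK : MetCat.HasReflexiveCoequalizers K) (G : K) (hG : MetCat.IsSubvarietalGenerator G) :
    MetCat.IsDenseSubcategory (MetCat.IsFiniteCopower G) :=
  theoremT_general hG le_rfl
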